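/- **Proposition.** Let $s$ be a natural number and consider an explicit $s$-stage Runge--Kutta method for autonomous systems $u'=G(u)$, $$v_0=u_n,\qquad v_i=u_n+\tau\sum_{j=0}^{i-1}a_{ij}G(v_j)\quad(1\le i\le s-1),\qquad u_{n+1}=u_n+\tau\sum_{j=0}^{s-1}b_jG(v_j),$$ with real coefficients. Put $a_{sj}=b_j$ for $0\le j\le s-1$, and let $A_L=(a_{ik})_{0\le i,k\le s}$ be the resulting strictly lower-triangular $(s+1)\times(s+1)$ matrix, with zeros on and above the diagonal. Suppose that the method is irreducible and that all strictly lower-triangular entries of $A_L$ are positive, i.e. $a_{ik}>0$ for all $0\le k<i\le s$ (so in particular all weights $b_k=a_{sk}$ are positive). Then the method cannot have order greater than $4$: if it has order $p$, then $p\le 4$. Here the method *has order $p$* ($p\in\mathbb N$) if for every $N$, every $C^\infty$ map $G:\mathbb R^N\to\mathbb R^N$ and every solution $u$ of $u'=G(u)$ on an interval $[0,T]$, $T>0$, the result $u_1(\tau)$ of one step of size $\tau$ started at $u(0)$ satisfies $u_1(\tau)-u(\tau)=O(\tau^{p+1})$ as $\tau\to0^+$. The method is *irreducible* if it is neither reducible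 in the sense of Dahlquist--Jeltsch (there is a nonempty set $S$ of stages with $b_j=0$ for $j\in S$ and $a_{ij}=0$ for all stages $i\notin S$, $j\in S$) nor reducible in the sense of Hundsdorfer--Spijker (the set of stages $\{0,\dots,s-1\}$ has a partition into $r<s$ nonempty classes such that for any two stages $i,j$ in a common class and every class $C$, $\sum_{k\in C}a_{ik}=\sum_{k\in C}a_{jk}$, where $a_{ik}=0$ for $k\ge i$). -/

import Mathlib

open Topology Asymptotics
open scoped ContDiff

/-- An explicit Runge–Kutta method with `s` stages (indexed from `0`): a strictly lower triangular
Runge–Kutta matrix `A` and weights `b`. The nodes are the row sums of `A`; they do not enter the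
scheme for an autonomous system `u' = G u`. -/
structure ExplicitRK (s : ℕ) where
  /-- the Runge–Kutta matrix -/
  A : Matrix (Fin s) (Fin s) ℝ
  /-- the weights -/
  b : Fin s → ℝ
  /-- the method is explicit -/
  explicit : ∀ i j : Fin s, i ≤ j → A i j = 0

namespace ExplicitRK

variable {s : ℕ}

/-- The `(s + 1) × (s + 1)` strictly lower triangular matrix of the method: the Runge–Kutta matrix
with the weights appended as the last row (`a_{s,j} = b_j`), and a last column of zeros. -/
def AL (M : ExplicitRK s) : Matrix (Fin (s + 1)) (Fin (s + 1)) ℝ :=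
  Matrix.of (Fin.snoc (α := fun _ => Fin (s + 1) → ℝ)
    (fun i : Fin s => Fin.snoc (α := fun _ => ℝ) (M.A i) 0) (Fin.snoc (α := fun _ => ℝ) M.b 0))

/-- The stages `v_i = u + τ ∑_{j < i} a_{ij} G(v_j)`, for `0 ≤ i ≤ s - 1`. -/
def stage {E : Type*} [AddCommGroup E] [Module ℝ E] (M : ExplicitRK s) (G : E → E) (u : E) (τ : ℝ)
    (i : Fin s) : E :=
  u + τ • ∑ j : Fin i.val,
    M.A i ⟨j.val, j.isLt.trans i.isLt⟩ • G (stage M G u τ ⟨j.val, j.isLt.trans i.isLt⟩)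
termination_by i.val
decreasing_by exact j.isLt

/-- One step of the method with step size `τ`: `u ↦ u + τ ∑_j b_j G(v_j)`. -/
def step {E : Type*} [AddCommGroup E] [Module ℝ E] (M : ExplicitRK s) (G : E → E) (u : E) (τ : ℝ) :
    E :=
  u + τ • ∑ j : Fin s, M.b j • G (M.stage G u τ j)

/-- The method has order (at least) `p`: for every smooth autonomous system `u' = G u` in any finite
dimension and every exact solution `u` on some interval `[0, T]`, the error after one step of size
`τ` started at `u 0` is `O(τ ^ (p + 1))` as `τ → 0⁺`. -/
def HasOrder (M : ExplicitRK s) (p : ℕ) : Prop :=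
  ∀ (N : ℕ) (G : EuclideanSpace ℝ (Fin N) → EuclideanSpace ℝ (Fin N)), ContDiff ℝ ∞ G →
    ∀ (u : ℝ → EuclideanSpace ℝ (Fin N)) (T : ℝ), 0 < T →
      (∀ t ∈ Set.Icc 0 T, HasDerivWithinAt u (G (u t)) (Set.Icc 0 T) t) →
        (fun τ : ℝ => M.step G (u 0) τ - u τ) =O[𝓝[>] (0 : ℝ)] fun τ : ℝ => τ ^ (p + 1)

/-- Reducibility in the sense of Dahlquist and Jeltsch: some nonempty set `S` of stages has no
influence on the result of a step. -/
def DJReducible (M : ExplicitRK s) : Prop :=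
  ∃ S : Finset (Fin s), S.Nonempty ∧ (∀ j ∈ S, M.b j = 0) ∧ ∀ i ∉ S, ∀ j ∈ S, M.A i j = 0

/-- Reducibility in the sense of Hundsdorfer and Spijker: the stages can be partitioned into
`r < s` classes (the fibres of `π`) such that, for any two stages of the same class, the partial
row sums of `A` over each class agree. -/
def HSReducible (M : ExplicitRK s) : Prop :=
  ∃ r : ℕ, r < s ∧ ∃ π : Fin s → Fin r, Function.Surjective π ∧
    ∀ i j : Fin s, π i = π j → ∀ m : Fin r,
      ∑ k : Fin s with π k = m, M.A i k = ∑ k : Fin s with π k = m, M.A j k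

/-- A method is irreducible if it is reducible in neither sense. -/
def Irreducible (M : ExplicitRK s) : Prop :=
  ¬ M.DJReducible ∧ ¬ M.HSReducible

end ExplicitRK

namespace ExplicitRK

variable {s : ℕ}

/-! Write `d_j = ∑_k a_{jk} c_k - c_j ^ 2 / 2`. Order five forces `∑_j b_j d_j ^ 2 = 0`, so positive
weights make every `d_j` vanish. But explicitness gives `d_1 = -a_{10} ^ 2 / 2`, which is nonzero.
No theory of rooted trees is needed: one polynomial test system, `stageOrderField`, has a third
component that is zero along the exact solution and equals `τ ^ 5 ∑_j b_j d_j ^ 2` after one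
numerical step. -/

theorem AL_castSucc_castSucc (M : ExplicitRK s) (i j : Fin s) :
    M.AL i.castSucc j.castSucc = M.A i j := by
  simp [AL]

theorem AL_last_castSucc (M : ExplicitRK s) (j : Fin s) :
    M.AL (Fin.last s) j.castSucc = M.b j := by
  simp [AL]

/-- The node of the stage `i`, i.e. the `i`-th row sum of the Runge–Kutta matrix. -/
noncomputable def node (M : ExplicitRK s) (i : Fin s) : ℝ :=
  ∑ j : Fin i.val, M.A i ⟨j.val, j.isLt.trans i.isLt⟩

/-- The residual `∑_j a_{ij} c_j - c_i ^ 2 / 2` of the condition for stage order two. -/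
noncomputable def stageDefect (M : ExplicitRK s) (i : Fin s) : ℝ :=
  ∑ j : Fin i.val, M.A i ⟨j.val, j.isLt.trans i.isLt⟩ * M.node ⟨j.val, j.isLt.trans i.isLt⟩ -
    M.node i ^ 2 / 2

theorem node_zero (M : ExplicitRK s) (h : 0 < s) : M.node ⟨0, h⟩ = 0 := by
  simp [node]

theorem node_one (M : ExplicitRK s) (h : 1 < s) :
    M.node ⟨1, h⟩ = M.A ⟨1, h⟩ ⟨0, Nat.zero_lt_of_lt h⟩ := by
  simp [node]

/-- Stage 1 uses only stage 0, whose node is zero, so the sum in the defect drops out. -/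
theorem stageDefect_one (M : ExplicitRK s) (h : 1 < s) :
    M.stageDefect ⟨1, h⟩ = -(M.A ⟨1, h⟩ ⟨0, Nat.zero_lt_of_lt h⟩ ^ 2 / 2) := by
  simp [stageDefect, node_one, node_zero]

/-- The vector field of the system `x' = 1`, `y' = x`, `z' = (y - x ^ 2 / 2) ^ 2`, whose solution
starting at the origin is `(t, t ^ 2 / 2, 0)`. -/
noncomputable def stageOrderField (v : EuclideanSpace ℝ (Fin 3)) : EuclideanSpace ℝ (Fin 3) :=
  !₂[1, v 0, (v 1 - v 0 ^ 2 / 2) ^ 2]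

/-- The solution of the system given by `stageOrderField` that starts at the origin. -/
noncomputable def stageOrderSolution (t : ℝ) : EuclideanSpace ℝ (Fin 3) :=
  !₂[t, t ^ 2 / 2, 0]

theorem contDiff_stageOrderField : ContDiff ℝ ∞ stageOrderField := by
  rw [contDiff_euclidean]
  intro i
  fin_cases i <;> simp [stageOrderField] <;> fun_prop

theorem hasDerivAt_stageOrderSolution (t : ℝ) :
    HasDerivAt stageOrderSolution (stageOrderField (stageOrderSolution t)) t := by
  rw [hasDerivAt_iff_hasFDerivAt, ← hasFDerivWithinAt_univ, hasFDerivWithinAt_euclidean]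
  intro i
  rw [hasFDerivWithinAt_univ, hasFDerivAt_iff_hasDerivAt]
  fin_cases i
  · simpa [stageOrderField, stageOrderSolution] using hasDerivAt_id' t
  · simpa [stageOrderField, stageOrderSolution] using (hasDerivAt_pow 2 t).div_const 2
  · simpa [stageOrderField, stageOrderSolution] using hasDerivAt_const t (0 : ℝ)

theorem stageOrderSolution_zero : stageOrderSolution 0 = 0 := by
  ext i
  fin_cases i <;> simp [stageOrderSolution]

theorem stage_stageOrderField_zero (M : ExplicitRK s) (τ : ℝ) (i : Fin s) :
    M.stage stageOrderField 0 τ i 0 = τ * M.node i := by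
  rw [stage]
  simp [stageOrderField, node]

theorem stage_stageOrderField_one (M : ExplicitRK s) (τ : ℝ) (i : Fin s) :
    M.stage stageOrderField 0 τ i 1 = τ ^ 2 *
      ∑ j : Fin i.val, M.A i ⟨j.val, j.isLt.trans i.isLt⟩ *
        M.node ⟨j.val, j.isLt.trans i.isLt⟩ := by
  rw [stage]
  simp only [stageOrderField, PiLp.smul_apply, zero_add,
    WithLp.ofLp_sum, Finset.sum_apply, smul_eq_mul, Matrix.cons_val_one, Matrix.cons_val_zero,
    stage_stageOrderField_zero, Finset.mul_sum]
  exact Finset.sum_congr rfl fun j _ => by ring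

theorem step_stageOrderField_one (M : ExplicitRK s) (τ : ℝ) :
    M.step stageOrderField 0 τ 1 = τ ^ 2 * ∑ j, M.b j * M.node j := by
  simp only [step, stageOrderField, PiLp.smul_apply, zero_add,
    WithLp.ofLp_sum, Finset.sum_apply, smul_eq_mul, Matrix.cons_val_one, Matrix.cons_val_zero,
    stage_stageOrderField_zero, Finset.mul_sum]
  exact Finset.sum_congr rfl fun j _ => by ring

/-- At stage `j` the quantity `y - x ^ 2 / 2` is exactly `τ ^ 2 d_j`; squaring it gives `τ ^ 4` and
the step contributes one more `τ`. -/
theorem step_stageOrderField_two (M : ExplicitRK s) (τ : ℝ) :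
    M.step stageOrderField 0 τ 2 = τ ^ 5 * ∑ j, M.b j * M.stageDefect j ^ 2 := by
  simp only [step, stageOrderField, PiLp.smul_apply, zero_add,
    WithLp.ofLp_sum, Finset.sum_apply, smul_eq_mul, Matrix.cons_val,
    stage_stageOrderField_zero, stage_stageOrderField_one, Finset.mul_sum, stageDefect]
  refine Finset.sum_congr rfl fun j _ => ?_
  rw [← Finset.mul_sum]
  ring

theorem eq_zero_of_pow_mul_isBigO_pow {c : ℝ} {k m : ℕ} (hkm : k < m)
    (h : (fun τ : ℝ => τ ^ k * c) =O[𝓝[>] (0 : ℝ)] fun τ : ℝ => τ ^ m) : c = 0 := by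
  by_contra hc
  have h1 : (fun τ : ℝ => τ ^ k * c) =o[𝓝[>] (0 : ℝ)] fun τ : ℝ => τ ^ k :=
    h.trans_isLittleO ((isLittleO_pow_pow hkm).mono nhdsWithin_le_nhds)
  have h2 : (fun τ : ℝ => τ ^ k) =o[𝓝[>] (0 : ℝ)] fun τ : ℝ => τ ^ k :=
    (isLittleO_const_mul_left_iff hc).1 (by simpa only [mul_comm] using h1)
  refine isLittleO_irrefl (Filter.Eventually.frequently ?_) h2
  filter_upwards [self_mem_nhdsWithin] with τ hτ
  exact pow_ne_zero k (ne_of_gt hτ)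

theorem HasOrder.isBigO_stageOrderField {M : ExplicitRK s} {p : ℕ} (hp : M.HasOrder p)
    (i : Fin 3) :
    (fun τ : ℝ => M.step stageOrderField 0 τ i - stageOrderSolution τ i)
      =O[𝓝[>] (0 : ℝ)] fun τ : ℝ => τ ^ (p + 1) := by
  have h := hp 3 stageOrderField contDiff_stageOrderField stageOrderSolution 1 one_pos
    fun t _ => (hasDerivAt_stageOrderSolution t).hasDerivWithinAt
  rw [stageOrderSolution_zero] at h
  refine (isBigO_of_le _ fun τ => ?_).trans h
  exact PiLp.norm_apply_le (M.step stageOrderField 0 τ - stageOrderSolution τ) i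

/-- A method of order at least two satisfies `∑_j b_j c_j = 1 / 2`. -/
theorem HasOrder.sum_b_mul_node {M : ExplicitRK s} {p : ℕ} (hp : M.HasOrder p) (h2 : 2 ≤ p) :
    ∑ j, M.b j * M.node j = 1 / 2 := by
  refine sub_eq_zero.1 (eq_zero_of_pow_mul_isBigO_pow (k := 2) (m := p + 1) (by omega) ?_)
  refine (hp.isBigO_stageOrderField 1).congr_left fun τ => ?_
  rw [step_stageOrderField_one]
  simp only [stageOrderSolution, Matrix.cons_val_one, Matrix.cons_val_zero]
  ring

/-- A method of order at least five satisfies `∑_j b_j (∑_k a_{jk} c_k - c_j ^ 2 / 2) ^ 2 = 0`. -/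
theorem HasOrder.sum_b_mul_stageDefect_sq {M : ExplicitRK s} {p : ℕ} (hp : M.HasOrder p)
    (h5 : 5 ≤ p) : ∑ j, M.b j * M.stageDefect j ^ 2 = 0 := by
  -- Order five is needed exactly here: `5 < p + 1`, whereas order four would allow a `τ ^ 5` error.
  refine eq_zero_of_pow_mul_isBigO_pow (k := 5) (m := p + 1) (by omega) ?_
  refine (hp.isBigO_stageOrderField 2).congr_left fun τ => ?_
  rw [step_stageOrderField_two]
  simp [stageOrderSolution]

/-- With at most one stage the only possible node is `c_0 = 0`, so `∑_j b_j c_j` cannot be `1 / 2`.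
This provides the stage 1 on which the final contradiction rests. -/
theorem HasOrder.one_lt_stages {M : ExplicitRK s} {p : ℕ} (hp : M.HasOrder p) (h2 : 2 ≤ p) :
    1 < s := by
  by_contra hs
  have h := hp.sum_b_mul_node h2
  rw [Finset.sum_eq_zero fun j _ => ?_] at h
  · norm_num at h
  · obtain ⟨j, hj⟩ := j
    obtain rfl : j = 0 := by omega
    rw [node_zero, mul_zero]

end ExplicitRK

theorem mainTheorem7 {s : ℕ} (M : ExplicitRK s) (hirr : M.Irreducible)
    (hpos : ∀ i k : Fin (s + 1), k < i → 0 < M.AL i k) (p : ℕ) (hp : M.HasOrder p) :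
    p ≤ 4 := by
  by_contra! h5
  have hs : 1 < s := hp.one_lt_stages (by omega)
  have hb : ∀ j, 0 < M.b j := fun j => by
    rw [← M.AL_last_castSucc]
    exact hpos _ _ (Fin.castSucc_lt_last j)
  have ha : 0 < M.A ⟨1, hs⟩ ⟨0, Nat.zero_lt_of_lt hs⟩ := by
    rw [← M.AL_castSucc_castSucc]
    exact hpos _ _ (Fin.castSucc_lt_castSucc_iff.2 Nat.zero_lt_one)
  -- A vanishing sum of nonnegative terms vanishes termwise; the term of stage 1 is the one that
  -- cannot.
  have h := (Finset.sum_eq_zero_iff_of_nonneg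
    fun j _ => mul_nonneg (hb j).le (sq_nonneg _)).1 (hp.sum_b_mul_stageDefect_sq h5)
      ⟨1, hs⟩ (Finset.mem_univ _)
  rw [M.stageDefect_one hs, neg_sq] at h
  have := hb ⟨1, hs⟩
  exact absurd h (ne_of_gt (by positivity))
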